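/- Let $0<q<1$ and let $L=\{\pm q^{2n}:n\in\mathbb Z\}$. For $f:L\to\mathbb C$ put $(\Lambda f)(x)=f(q^2x)$ and $(\partial f)(x)=\dfrac{f(x)-f(q^2x)}{(1-q^2)x}$. Let $S$ be the space of all $\psi:L\to\mathbb C$ with $p_{k,l}(\psi)=\sup_{x\in L}|x^k\partial^l\psi(x)|<\infty$ for all integers $k,l\ge 0$, with the topology given by the seminorms $p_{k,l}$, and let $S'$ be the space of continuous linear functionals on $S$ (the $q^2$-distributions). The $q^2$-derivative of $f\in S'$ is defined by $\langle\partial f,\varphi\rangle=-\langle\Lambda f,\partial\varphi\rangle$, where $\langle\Lambda f,\varphi\rangle=q^{-2}\langle f,\Lambda^{-1}\varphi\rangle$. The $q^2$-shift of $\psi\in S$ is $$T_\xi\psi(s)=\sum_{k=0}^\infty\frac{(1-q^2)^k}{(q^2,q^2)_k}\,\xi^k\,(\Lambda_s^{-k}\partial_s^k\psi)(s),\qquad \xi,s\in L,\qquad (q^2,q^2)_k=\prod_{i=1}^{k}(1-q^{2i}).$$ For $g\in S'$ and $F:L\to\mathbb C$ say that $\langle g,F\rangle$ exists if $F\mathbf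 1_{\{|x|\le1\}}\in S$ and $\sum_{x\in L,\,|x|>1}|\langle g,\mathbf 1_{\{x\}}\rangle F(x)|<\infty$; then $\langle g,F\rangle=\langle g,F\mathbf 1_{\{|x|\le1\}}\rangle+\sum_{x\in L,\,|x|>1}\langle g,\mathbf 1_{\{x\}}\rangle F(x)$. For $r\in S'$ let $L_r$ be the union of those of the two half-lattices $\{q^{2n}\}$, $\{-q^{2n}\}$ for which some $\varphi\in S$ supported in it has $\langle r,\varphi\rangle\ne0$. Say that the $q^2$-convolution $g*r$ exists if, for every $\psi\in S$, $\langle g(\xi),T_\xi\psi(s)\rangle$ exists for every $s\in L_r$ and the function equal to it on $L_r$ and to $0$ on $L\setminus L_r$ belongs to $S$; then $\langle g*r,\psi\rangle=\langle r(s),\langle g(\xi),T_\xi\psi(s)\rangle\rangle$ is the value of $r$ on that function. (In particular $g*r$ exists for all $r\in S'$ if $g$ is a $q^2$-convolutor, i.e. if $(g*\psi)(s)=\langle g(\xi),T_\xi\psi(s)\rangle$ exists for all $s\in L$ and defines an element of $S$, for every $\psi\in S$.) **Proposition 5.4.** Let $g,r\in S'$ be such that $g*r$ exists. Then $(\partial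 g)*r$ and $g*(\partial r)$ exist, and $$(\partial g)*r=g*(\partial r),$$ that is, $\langle(\partial g)*r,\psi\rangle=\langle g*(\partial r),\psi\rangle$ for every $\psi\in S$. -/

import Mathlib

noncomputable section

namespace QConvolution

/-- The two-sided lattice `{± q^(2n) : n ∈ ℤ}`: the pair `(ε, n)` stands for the point
`ε q^(2n)`. -/
abbrev Lattice : Type := ℤˣ × ℤ

/-- The base `0 < q < 1`. -/
abbrev Base : Type := Set.Ioo (0 : ℝ) 1

/-- The real number `ε q^(2n)` represented by `(ε, n)`. -/
def pt (q : Base) (p : Lattice) : ℝ := ((p.1 : ℤ) : ℝ) * (q : ℝ) ^ (2 * p.2)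

/-- `(Λ^j f)(x) = f(q^(2j) x)` for an integer `j`. -/
def dilate (j : ℤ) : (Lattice → ℂ) →ₗ[ℂ] (Lattice → ℂ) where
  toFun f p := f (p.1, p.2 + j)
  map_add' _ _ := rfl
  map_smul' _ _ := rfl

/-- The `q²`-derivative `(∂f)(x) = (f(x) - f(q² x)) / ((1 - q²) x)`. -/
def qDeriv (q : Base) : (Lattice → ℂ) →ₗ[ℂ] (Lattice → ℂ) where
  toFun f p := (f p - f (p.1, p.2 + 1)) / ((1 - (q : ℂ) ^ 2) * (pt q p : ℂ))
  map_add' f g := by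
    funext p
    simp only [Pi.add_apply]
    ring
  map_smul' c f := by
    funext p
    simp only [Pi.smul_apply, smul_eq_mul, RingHom.id_apply]
    ring

/-- The function `x ^ k (∂^l f)(x)` on the lattice. -/
def weighted (q : Base) (k l : ℕ) (f : Lattice → ℂ) (p : Lattice) : ℂ :=
  (pt q p : ℂ) ^ k * (qDeriv q ^ l) f p

/-- The functions `f` on the lattice with `|x ^ k (∂^l f)(x)| ≤ C_{k,l}` for all `k, l ≥ 0`. -/
def testSubmodule (q : Base) : Submodule ℂ (Lattice → ℂ) where
  carrier := {f | ∀ k l : ℕ, ∃ C : ℝ, ∀ p, ‖weighted q k l f p‖ ≤ C}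
  zero_mem' := fun k l => ⟨0, fun p => by simp [weighted]⟩
  add_mem' := by
    intro f g hf hg k l
    obtain ⟨C, hC⟩ := hf k l
    obtain ⟨D, hD⟩ := hg k l
    refine ⟨C + D, fun p => ?_⟩
    have : weighted q k l (f + g) p = weighted q k l f p + weighted q k l g p := by
      simp [weighted, mul_add]
    rw [this]
    exact (norm_add_le _ _).trans (add_le_add (hC p) (hD p))
  smul_mem' := by
    intro c f hf k l
    obtain ⟨C, hC⟩ := hf k l
    refine ⟨‖c‖ * C, fun p => ?_⟩
    have : weighted q k l (c • f) p = c * weighted q k l f p := by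
      simp [weighted, mul_left_comm]
    rw [this, norm_mul]
    exact mul_le_mul_of_nonneg_left (hC p) (norm_nonneg c)

/-- The space of test functions. It is a copy of `testSubmodule q`, so that it does not carry
the topology of pointwise convergence. -/
def TestFun (q : Base) : Type := testSubmodule q

instance (q : Base) : AddCommGroup (TestFun q) := inferInstanceAs (AddCommGroup (testSubmodule q))

instance (q : Base) : Module ℂ (TestFun q) := inferInstanceAs (Module ℂ (testSubmodule q))

instance (q : Base) : CoeFun (TestFun q) (fun _ => Lattice → ℂ) := ⟨fun φ => φ.1⟩

theorem TestFun.bddAbove {q : Base} (φ : TestFun q) (k l : ℕ) :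
    BddAbove (Set.range fun p => ‖weighted q k l φ p‖) := by
  obtain ⟨C, hC⟩ := φ.2 k l
  exact ⟨C, by rintro _ ⟨p, rfl⟩; exact hC p⟩

/-- The seminorm `sup_x |x ^ k (∂^l φ)(x)|`. -/
def testSeminorm (q : Base) (kl : ℕ × ℕ) : Seminorm ℂ (TestFun q) :=
  Seminorm.of (fun φ => ⨆ p, ‖weighted q kl.1 kl.2 φ p‖)
    (by
      intro φ χ
      refine ciSup_le fun p => ?_
      have h : weighted q kl.1 kl.2 (φ + χ : TestFun q) p
          = weighted q kl.1 kl.2 φ p + weighted q kl.1 kl.2 χ p := by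
        change weighted q kl.1 kl.2 (φ.1 + χ.1) p = _
        simp [weighted, mul_add]
      rw [h]
      exact (norm_add_le _ _).trans (add_le_add (le_ciSup (φ.bddAbove kl.1 kl.2) p)
        (le_ciSup (χ.bddAbove kl.1 kl.2) p)))
    (by
      intro c φ
      rw [Real.mul_iSup_of_nonneg (norm_nonneg c)]
      refine congrArg _ (funext fun p => ?_)
      have h : weighted q kl.1 kl.2 (c • φ : TestFun q) p = c * weighted q kl.1 kl.2 φ p := by
        change weighted q kl.1 kl.2 (c • φ.1) p = _
        simp [weighted, mul_left_comm]
      rw [h, norm_mul])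

/-- The seminorms that define the topology of the space of test functions. -/
def testSeminormFamily (q : Base) : SeminormFamily ℂ (TestFun q) (ℕ × ℕ) := testSeminorm q

instance (q : Base) : TopologicalSpace (TestFun q) :=
  (testSeminormFamily q).moduleFilterBasis.topology

theorem testFun_withSeminorms (q : Base) : WithSeminorms (testSeminormFamily q) := ⟨rfl⟩

/-- The `q²`-distributions: the continuous linear functionals on the space of test functions. -/
abbrev Distr (q : Base) : Type := TestFun q →L[ℂ] ℂ

theorem pt_ne_zero (q : Base) (p : Lattice) : pt q p ≠ 0 := by
  have hq : (q : ℝ) ≠ 0 := q.2.1.ne'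
  have h1 : ((p.1 : ℤ) : ℝ) ≠ 0 := by exact_mod_cast p.1.ne_zero
  exact mul_ne_zero h1 (zpow_ne_zero _ hq)

theorem pt_shift (q : Base) (p : Lattice) (j : ℤ) :
    pt q (p.1, p.2 + j) = (q : ℝ) ^ (2 * j) * pt q p := by
  have hq : (q : ℝ) ≠ 0 := q.2.1.ne'
  simp only [pt, mul_add, zpow_add₀ hq]
  ring

theorem qDeriv_dilate (q : Base) (j : ℤ) (f : Lattice → ℂ) :
    qDeriv q (dilate j f) = ((q : ℂ) ^ (2 * j)) • dilate j (qDeriv q f) := by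
  have hq : (q : ℂ) ≠ 0 := by exact_mod_cast q.2.1.ne'
  funext p
  have h1 : (p.2 + 1 + j) = (p.2 + j + 1) := by ring
  have hs := pt_shift q p j
  simp only [qDeriv, dilate, LinearMap.coe_mk, AddHom.coe_mk, Pi.smul_apply, smul_eq_mul, h1, hs]
  push_cast
  have hz : (q : ℂ) ^ (2 * j) ≠ 0 := zpow_ne_zero _ hq
  rw [mul_left_comm (1 - (q : ℂ) ^ 2), ← mul_div_assoc, mul_div_mul_left _ _ hz]

theorem qDeriv_pow_dilate (q : Base) (j : ℤ) (l : ℕ) (f : Lattice → ℂ) :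
    (qDeriv q ^ l) (dilate j f) = ((q : ℂ) ^ (2 * j)) ^ l • dilate j ((qDeriv q ^ l) f) := by
  induction l with
  | zero => simp
  | succ l ih =>
    rw [pow_succ', Module.End.mul_apply, ih, map_smul, qDeriv_dilate, smul_smul, ← pow_succ,
      Module.End.mul_apply]

/-- The weighted derivatives of `Λ⁻¹ ∂ f` in terms of those of `f`. -/
theorem weighted_dilateInv_qDeriv (q : Base) (k l : ℕ) (f : Lattice → ℂ) (p : Lattice) :
    weighted q k l (dilate (-1) (qDeriv q f)) p
      = (((q : ℂ) ^ (2 * (-1 : ℤ))) ^ l * ((q : ℂ) ^ (2 : ℤ)) ^ k)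
        * weighted q k (l + 1) f (p.1, p.2 + (-1)) := by
  have h := pt_shift q (p.1, p.2 + (-1)) 1
  simp only [neg_add_cancel_right, mul_one] at h
  simp only [weighted]
  rw [qDeriv_pow_dilate, h, pow_succ, Module.End.mul_apply]
  simp only [dilate, LinearMap.coe_mk, AddHom.coe_mk, Pi.smul_apply, smul_eq_mul]
  push_cast
  rw [mul_pow]
  ring

/-- The operator `Λ⁻¹ ∂` on test functions, `(Λ⁻¹ ∂ φ)(x) = (∂φ)(q⁻² x)`. -/
def testDilateInvDerivₗ (q : Base) : TestFun q →ₗ[ℂ] TestFun q where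
  toFun φ := ⟨dilate (-1) (qDeriv q φ.1), fun k l => by
    obtain ⟨C, hC⟩ := φ.2 k (l + 1)
    refine ⟨‖(((q : ℂ) ^ (2 * (-1 : ℤ))) ^ l * ((q : ℂ) ^ (2 : ℤ)) ^ k)‖ * C, fun p => ?_⟩
    rw [weighted_dilateInv_qDeriv, norm_mul]
    exact mul_le_mul_of_nonneg_left (hC _) (norm_nonneg _)⟩
  map_add' φ χ := Subtype.ext (by
    change dilate (-1) (qDeriv q (φ.1 + χ.1)) = _
    rw [map_add, map_add]; rfl)
  map_smul' c φ := Subtype.ext (by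
    change dilate (-1) (qDeriv q (c • φ.1)) = _
    rw [map_smul, map_smul]; rfl)

theorem testDilateInvDerivₗ_continuous (q : Base) : Continuous (testDilateInvDerivₗ q) := by
  refine WithSeminorms.continuous_of_isBounded (testFun_withSeminorms q) (testFun_withSeminorms q)
    _ fun kl => ?_
  refine ⟨{(kl.1, kl.2 + 1)},
    ‖(((q : ℂ) ^ (2 * (-1 : ℤ))) ^ kl.2 * ((q : ℂ) ^ (2 : ℤ)) ^ kl.1)‖₊, fun φ => ?_⟩
  rw [Finset.sup_singleton]
  change (⨆ p, ‖weighted q kl.1 kl.2 (dilate (-1) (qDeriv q φ.1)) p‖)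
    ≤ ‖(((q : ℂ) ^ (2 * (-1 : ℤ))) ^ kl.2 * ((q : ℂ) ^ (2 : ℤ)) ^ kl.1)‖
      * ⨆ p, ‖weighted q kl.1 (kl.2 + 1) φ p‖
  refine ciSup_le fun p => ?_
  rw [weighted_dilateInv_qDeriv, norm_mul]
  exact mul_le_mul_of_nonneg_left
    (le_ciSup (φ.bddAbove kl.1 (kl.2 + 1)) (p.1, p.2 + (-1))) (norm_nonneg _)

/-- `Λ⁻¹ ∂` as a continuous operator on test functions. -/
def testDilateInvDeriv (q : Base) : TestFun q →L[ℂ] TestFun q :=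
  ⟨testDilateInvDerivₗ q, testDilateInvDerivₗ_continuous q⟩

/-- The `q²`-derivative of a distribution, `<∂f, φ> = -<Λf, ∂φ>`, where
`<Λf, φ> = q⁻² <f, Λ⁻¹ φ>` is the change of variables in the Jackson integral. -/
def Distr.deriv {q : Base} (f : Distr q) : Distr q :=
  (-((q : ℂ) ^ 2)⁻¹) • f.comp (testDilateInvDeriv q)

/-- The `q`-shifted factorial `(a, b)_n = (1 - a)(1 - a b) ⋯ (1 - a b^(n-1))`. -/
def qFactorial (a b : ℂ) (n : ℕ) : ℂ := ∏ i ∈ Finset.range n, (1 - a * b ^ i)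

/-- The `q²`-shift
`T_ξ ψ(s) = e_{q²}((1 - q²) ξ Λ_s⁻¹ ∂_s) ψ(s) = ∑_k (1 - q²)^k / (q², q²)_k ξ^k (Λ_s^{-k} ∂_s^k ψ)(s)`,
the variables being ordered with the subordinate variable `s` to the right of `ξ` before they are
restricted to the lattice. For a bounded function `ψ` the series converges absolutely. -/
def shift (q : Base) (ψ : Lattice → ℂ) (ξ s : Lattice) : ℂ :=
  ∑' k : ℕ, (1 - (q : ℂ) ^ 2) ^ k / qFactorial ((q : ℂ) ^ 2) ((q : ℂ) ^ 2) k
    * (pt q ξ : ℂ) ^ k * dilate (-(k : ℤ)) ((qDeriv q ^ k) ψ) s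

open Classical in
/-- The value `<g, F>` if `F` is a test function (and `0` otherwise). -/
def Distr.eval {q : Base} (g : Distr q) (F : Lattice → ℂ) : ℂ :=
  if h : F ∈ testSubmodule q then g ⟨F, h⟩ else 0

/-- The restriction of `F` to `|x| ≤ 1`, extended by `0`. -/
def inner (F : Lattice → ℂ) (p : Lattice) : ℂ := if 0 ≤ p.2 then F p else 0

/-- The point masses: the indicator of a lattice point is a test function. -/
theorem single_mem_testSubmodule (q : Base) (p : Lattice) :
    (Pi.single p 1 : Lattice → ℂ) ∈ testSubmodule q := by
  have key : ∀ l : ℕ, ((qDeriv q ^ l) (Pi.single p 1 : Lattice → ℂ)).support.Finite := by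
    intro l
    induction l with
    | zero =>
      refine (Set.finite_singleton p).subset fun x hx => ?_
      by_contra h
      exact hx (by simpa using Pi.single_eq_of_ne (M := fun _ : Lattice => ℂ) h 1)
    | succ l ih =>
      rw [pow_succ', Module.End.mul_apply]
      set f := (qDeriv q ^ l) (Pi.single p 1 : Lattice → ℂ)
      refine (ih.union (ih.preimage (f := fun x : Lattice => (x.1, x.2 + 1)) ?_)).subset ?_
      · rintro ⟨a, b⟩ _ ⟨c, d⟩ _ h
        simpa using h
      · intro x hx
        by_contra h
        simp only [Set.mem_union, Set.mem_preimage, Function.mem_support, not_or, not_not] at h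
        exact hx (by simp [qDeriv, h.1, h.2])
  intro k l
  have hfin : (Set.range fun x => ‖weighted q k l (Pi.single p 1) x‖).Finite := by
    refine (((key l).image fun x => ‖weighted q k l (Pi.single p 1) x‖).union
      (Set.finite_singleton 0)).subset ?_
    rintro _ ⟨x, rfl⟩
    by_cases hx : x ∈ ((qDeriv q ^ l) (Pi.single p 1 : Lattice → ℂ)).support
    · exact Or.inl ⟨x, hx, rfl⟩
    · refine Or.inr ?_
      simp only [Function.mem_support, not_not] at hx
      simp [weighted, hx]
  obtain ⟨C, hC⟩ := hfin.bddAbove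
  exact ⟨C, fun x => hC ⟨x, rfl⟩⟩

/-- The value of `g` on the indicator of the lattice point `p`. -/
def Distr.mass {q : Base} (g : Distr q) (p : Lattice) : ℂ :=
  g ⟨Pi.single p 1, single_mem_testSubmodule q p⟩

/-- `<g, F>` exists for a function `F` on the lattice that need not decrease at infinity: `F` is
smooth at the origin, in the sense that its restriction to `|x| ≤ 1` is a test function, and the
part of `<g, F>` from `|x| > 1`, which is a series over lattice points, converges absolutely. -/
def Distr.PairingExists {q : Base} (g : Distr q) (F : Lattice → ℂ) : Prop :=
  inner F ∈ testSubmodule q ∧ Summable fun p : {p : Lattice // p.2 < 0} => g.mass p * F p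

/-- The value `<g, F>`, the limit of `<g, F · 1_{|x| ≤ R}>` as `R → ∞`. It is the value of the
functional `g` if `F` is a test function, and the Jackson integral
`∫ d_{q²}x conj(g(x)) F(x)` if `g` is regular. -/
def Distr.pairing {q : Base} (g : Distr q) (F : Lattice → ℂ) : ℂ :=
  g.eval (inner F) + ∑' p : {p : Lattice // p.2 < 0}, g.mass p * F p

/-- The signs `ε` such that `r` does not vanish on the half-lattice `{ε q^(2n)}`. Thus `r` is
concentrated on the union of the half-lattices whose sign is in this set. -/
def Distr.signSupport {q : Base} (r : Distr q) : Set ℤˣ :=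
  {ε | ∃ φ : TestFun q, (∀ p : Lattice, p.1 ≠ ε → φ p = 0) ∧ r φ ≠ 0}

open Classical in
/-- The function `(g * ψ)(s) = <g(ξ), T_ξ ψ(s)>`, on the half-lattices where `r` is concentrated
(and `0` elsewhere, which does not affect the value of `r`). -/
def convFun {q : Base} (g r : Distr q) (ψ : TestFun q) (s : Lattice) : ℂ :=
  if s.1 ∈ r.signSupport then g.pairing (fun ξ => shift q ψ ξ s) else 0

/-- The `q²`-convolution `g * r` exists: for every test function `ψ`, the function
`(g * ψ)(s) = <g(ξ), T_ξ ψ(s)>` exists and is a test function where `r` is concentrated.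
If `g` is a `q²`-convolutor, that is, if `g * ψ` exists on the whole lattice and is a test function
for every `ψ`, then `g * r` exists for every distribution `r`. -/
def ConvExists {q : Base} (g r : Distr q) : Prop :=
  ∀ ψ : TestFun q,
    (∀ s : Lattice, s.1 ∈ r.signSupport → g.PairingExists fun ξ => shift q ψ ξ s) ∧
      convFun g r ψ ∈ testSubmodule q

/-- The `q²`-convolution `<g * r, ψ> = <g(ξ) × r(s), T_ξ ψ(s)> = <r(s), <g(ξ), T_ξ ψ(s)>>`. -/
def conv {q : Base} (g r : Distr q) (ψ : TestFun q) : ℂ := r.eval (convFun g r ψ)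

end QConvolution

end

namespace QConvolution

noncomputable section

variable {q : Base}

/-! Put `D = Λ⁻¹ ∂`, so that `<∂f, φ> = -q⁻² <f, D φ>`. The shift behaves like an exponential:
applying `D` to `T_ξ ψ(s)` in `ξ`, or in `s`, gives `T_ξ (D ψ)(s)` both times
(`dilateInvDeriv_shift_left`, `dilateInvDeriv_shift_right`). Write `G_ψ(s) = <g(ξ), T_ξ ψ(s)>`.
Moving the derivative off `g` replaces `G_ψ` by `-q⁻² G_{Dψ}`; moving it off `r` replaces `G_ψ` by
`-q⁻² D G_ψ`, and `D G_ψ = G_{Dψ}`. Both convolutions are therefore `-q⁻² <r, G_{Dψ}>`.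

Two points need care. `T_ξ ψ(s)` need not be a test function of `ξ`, so the rule for `∂g` has to be
proved for the extended pairing; this is a summation by parts whose boundary terms at `±1` cancel
(`Distr.pairing_deriv`). Also, `G_ψ` is only defined on the half-lattices of `r`; since `D` never
mixes signs, passing from `r` to `∂r` creates no new ones (`Distr.signSupport_deriv_subset`). -/

theorem base_sq_pos (q : Base) : (0 : ℝ) < (q : ℝ) ^ 2 := pow_pos q.2.1 2

theorem base_sq_lt_one (q : Base) : (q : ℝ) ^ 2 < 1 := pow_lt_one₀ q.2.1.le q.2.2 two_ne_zero

theorem base_sq_ne_zero (q : Base) : (q : ℂ) ^ 2 ≠ 0 := by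
  exact_mod_cast (base_sq_pos q).ne'

theorem one_sub_base_sq_pow_ne_zero (q : Base) (k : ℕ) : 1 - ((q : ℂ) ^ 2) ^ (k + 1) ≠ 0 := by
  have h : (1 : ℝ) - ((q : ℝ) ^ 2) ^ (k + 1) ≠ 0 :=
    (sub_pos.2 (pow_lt_one₀ (base_sq_pos q).le (base_sq_lt_one q) k.succ_ne_zero)).ne'
  exact_mod_cast h

theorem one_sub_base_sq_ne_zero (q : Base) : 1 - (q : ℂ) ^ 2 ≠ 0 := by
  simpa using one_sub_base_sq_pow_ne_zero q 0

theorem ofReal_pt_ne_zero (q : Base) (p : Lattice) : (pt q p : ℂ) ≠ 0 := by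
  exact_mod_cast pt_ne_zero q p

/-- `q² (q⁻² x) = x`. -/
theorem sq_mul_pt_sub_one (q : Base) (p : Lattice) :
    (q : ℂ) ^ 2 * (pt q (p.1, p.2 + -1) : ℂ) = pt q p := by
  have h := pt_shift q (p.1, p.2 + -1) 1
  simp only [neg_add_cancel_right, mul_one] at h
  rw [h]
  push_cast
  rfl

/-- The operator `Λ⁻¹ ∂` on all functions on the lattice. -/
def dilateInvDeriv (q : Base) : (Lattice → ℂ) →ₗ[ℂ] (Lattice → ℂ) := dilate (-1) ∘ₗ qDeriv q

theorem dilateInvDeriv_apply (f : Lattice → ℂ) (p : Lattice) :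
    dilateInvDeriv q f p
      = (f (p.1, p.2 + -1) - f p) / ((1 - (q : ℂ) ^ 2) * (pt q (p.1, p.2 + -1) : ℂ)) := by
  simp [dilateInvDeriv, dilate, qDeriv]

theorem coe_testDilateInvDeriv (φ : TestFun q) :
    (testDilateInvDeriv q φ : Lattice → ℂ) = dilateInvDeriv q φ := rfl

theorem Distr.deriv_apply (f : Distr q) (φ : TestFun q) :
    f.deriv φ = -((q : ℂ) ^ 2)⁻¹ * f (testDilateInvDeriv q φ) := rfl

theorem dilateInvDeriv_mem {f : Lattice → ℂ} (hf : f ∈ testSubmodule q) :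
    dilateInvDeriv q f ∈ testSubmodule q :=
  (testDilateInvDeriv q ⟨f, hf⟩).2

theorem Distr.eval_of_mem (g : Distr q) {F : Lattice → ℂ} (h : F ∈ testSubmodule q) :
    g.eval F = g ⟨F, h⟩ := dif_pos h

theorem Distr.eval_add (g : Distr q) {F G : Lattice → ℂ} (hF : F ∈ testSubmodule q)
    (hG : G ∈ testSubmodule q) : g.eval (F + G) = g.eval F + g.eval G := by
  rw [g.eval_of_mem hF, g.eval_of_mem hG, g.eval_of_mem (add_mem hF hG)]
  exact g.map_add (⟨F, hF⟩ : TestFun q) (⟨G, hG⟩ : TestFun q)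

theorem Distr.eval_smul (g : Distr q) (c : ℂ) {F : Lattice → ℂ} (hF : F ∈ testSubmodule q) :
    g.eval (c • F) = c * g.eval F := by
  rw [g.eval_of_mem hF, g.eval_of_mem (Submodule.smul_mem _ c hF)]
  exact g.map_smul c (⟨F, hF⟩ : TestFun q)

theorem Distr.eval_single (g : Distr q) (p : Lattice) : g.eval (Pi.single p 1) = g.mass p :=
  g.eval_of_mem _

theorem Distr.eval_deriv (g : Distr q) {F : Lattice → ℂ} (hF : F ∈ testSubmodule q) :
    g.deriv.eval F = -((q : ℂ) ^ 2)⁻¹ * g.eval (dilateInvDeriv q F) := by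
  rw [g.deriv.eval_of_mem hF, g.eval_of_mem (dilateInvDeriv_mem hF)]
  rfl

/-! ### Restriction to half-lattices -/

/-- The restriction of a function to the half-lattices with sign in `A`. -/
def signRestrict (A : Set ℤˣ) (f : Lattice → ℂ) : Lattice → ℂ := {p | p.1 ∈ A}.indicator f

theorem signRestrict_apply_of_mem {A : Set ℤˣ} (f : Lattice → ℂ) {p : Lattice} (h : p.1 ∈ A) :
    signRestrict A f p = f p := Set.indicator_of_mem (s := {p : Lattice | p.1 ∈ A}) h f

theorem signRestrict_apply_of_notMem {A : Set ℤˣ} (f : Lattice → ℂ) {p : Lattice} (h : p.1 ∉ A) :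
    signRestrict A f p = 0 := Set.indicator_of_notMem (s := {p : Lattice | p.1 ∈ A}) h f

/-- `∂` compares only points of equal sign, so a cut between the half-lattices costs no regularity
at the origin. -/
theorem qDeriv_signRestrict (A : Set ℤˣ) (f : Lattice → ℂ) :
    qDeriv q (signRestrict A f) = signRestrict A (qDeriv q f) := by
  funext p
  by_cases h : p.1 ∈ A
  · have h' : ((p.1, p.2 + 1) : Lattice).1 ∈ A := h
    simp [qDeriv, signRestrict_apply_of_mem _ h, signRestrict_apply_of_mem _ h']
  · have h' : ((p.1, p.2 + 1) : Lattice).1 ∉ A := h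
    simp [qDeriv, signRestrict_apply_of_notMem _ h, signRestrict_apply_of_notMem _ h']

theorem qDeriv_pow_signRestrict (A : Set ℤˣ) (l : ℕ) (f : Lattice → ℂ) :
    (qDeriv q ^ l) (signRestrict A f) = signRestrict A ((qDeriv q ^ l) f) := by
  induction l with
  | zero => simp
  | succ l ih =>
    rw [pow_succ', Module.End.mul_apply, ih, qDeriv_signRestrict, Module.End.mul_apply]

theorem signRestrict_mem (A : Set ℤˣ) {f : Lattice → ℂ} (hf : f ∈ testSubmodule q) :
    signRestrict A f ∈ testSubmodule q := by
  intro k l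
  obtain ⟨C, hC⟩ := hf k l
  refine ⟨C, fun p => ?_⟩
  rw [weighted, qDeriv_pow_signRestrict]
  by_cases h : p.1 ∈ A
  · rw [signRestrict_apply_of_mem _ h]
    exact hC p
  · rw [signRestrict_apply_of_notMem _ h, mul_zero, norm_zero]
    exact (norm_nonneg _).trans (hC p)

theorem Distr.eval_eq_zero_of_forall_sign (r : Distr q) {ε : ℤˣ} (hε : ε ∉ r.signSupport)
    {f : Lattice → ℂ} (hf : f ∈ testSubmodule q) (h : ∀ p : Lattice, p.1 ≠ ε → f p = 0) :
    r.eval f = 0 := by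
  by_contra hne
  rw [r.eval_of_mem hf] at hne
  exact hε ⟨⟨f, hf⟩, h, hne⟩

/-- A distribution vanishes on the test functions that vanish on its half-lattices. -/
theorem Distr.eval_eq_zero_of_signSupport (r : Distr q) {f : Lattice → ℂ}
    (hf : f ∈ testSubmodule q) (h : ∀ p : Lattice, p.1 ∈ r.signSupport → f p = 0) :
    r.eval f = 0 := by
  have hpart : ∀ ε : ℤˣ, r.eval (signRestrict {ε} f) = 0 := by
    intro ε
    by_cases hε : ε ∈ r.signSupport
    · have h0 : signRestrict {ε} f = (0 : ℂ) • f := by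
        funext p
        by_cases hp : p.1 ∈ ({ε} : Set ℤˣ)
        · rw [signRestrict_apply_of_mem _ hp, h p (by rw [Set.mem_singleton_iff.1 hp]; exact hε)]
          simp [h p (by rw [Set.mem_singleton_iff.1 hp]; exact hε)]
        · rw [signRestrict_apply_of_notMem _ hp]
          simp
      rw [h0, r.eval_smul _ hf, zero_mul]
    · exact r.eval_eq_zero_of_forall_sign hε (signRestrict_mem _ hf) fun p hp =>
        signRestrict_apply_of_notMem _ hp
  have hsum : f = signRestrict {1} f + signRestrict {-1} f := by
    funext p
    rcases Int.units_eq_one_or p.1 with hp | hp <;>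
      simp [signRestrict, Set.indicator, hp]
  rw [hsum, r.eval_add (signRestrict_mem _ hf) (signRestrict_mem _ hf), hpart, hpart, add_zero]

/-- The value of a distribution depends only on the values of the test function on its
half-lattices. -/
theorem Distr.eval_congr_signSupport (r : Distr q) {f f' : Lattice → ℂ}
    (hf : f ∈ testSubmodule q) (hf' : f' ∈ testSubmodule q)
    (h : ∀ p : Lattice, p.1 ∈ r.signSupport → f p = f' p) : r.eval f = r.eval f' := by
  have hd : f - f' ∈ testSubmodule q := sub_mem hf hf'
  have h0 := r.eval_eq_zero_of_signSupport hd fun p hp => by simp [h p hp]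
  rw [← sub_add_cancel f f', r.eval_add hd hf', h0, zero_add]

/-- `Λ⁻¹ ∂` keeps a function inside its half-lattice, so a test function that detects `∂r` there
yields one that detects `r`. -/
theorem Distr.signSupport_deriv_subset (r : Distr q) : r.deriv.signSupport ⊆ r.signSupport := by
  rintro ε ⟨φ, hφ, hne⟩
  refine ⟨testDilateInvDeriv q φ, fun p hp => ?_, fun h0 => hne ?_⟩
  · rw [coe_testDilateInvDeriv, dilateInvDeriv_apply, hφ p hp, hφ (p.1, p.2 + -1) hp]
    simp
  · rw [Distr.deriv_apply, h0, mul_zero]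

/-! ### The pairing of a derivative -/

/-- Since `Λ⁻¹ ∂` reads `x` and `q⁻² x`, a point mass at `p` spreads to `p` and `q² p`. This gives
the masses of `∂g` in `mass_deriv`. -/
theorem dilateInvDeriv_single (p : Lattice) :
    dilateInvDeriv q (Pi.single p 1)
      = ((1 - (q : ℂ) ^ 2) * (pt q p : ℂ))⁻¹ • Pi.single (p.1, p.2 + 1) 1
        + (-((1 - (q : ℂ) ^ 2) * (pt q (p.1, p.2 + -1) : ℂ))⁻¹) • Pi.single p 1 := by
  funext x
  obtain ⟨ε, n⟩ := p
  obtain ⟨δ, m⟩ := x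
  rw [dilateInvDeriv_apply]
  simp only [Pi.add_apply, Pi.smul_apply, Pi.single_apply, Prod.mk.injEq, smul_eq_mul]
  by_cases hs : δ = ε
  · subst hs
    by_cases h1 : m = n
    · subst h1
      simp [div_eq_mul_inv]
    · by_cases h2 : m = n + 1
      · subst h2
        simp
      · have h3 : ¬ (m + -1 = n) := by omega
        simp [h1, h2, h3]
  · simp [hs]

theorem Distr.mass_deriv (g : Distr q) (p : Lattice) :
    g.deriv.mass p = -((q : ℂ) ^ 2)⁻¹ *
      (((1 - (q : ℂ) ^ 2) * (pt q p : ℂ))⁻¹ * g.mass (p.1, p.2 + 1)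
        - ((1 - (q : ℂ) ^ 2) * (pt q (p.1, p.2 + -1) : ℂ))⁻¹ * g.mass p) := by
  have hs := single_mem_testSubmodule q
  rw [← g.deriv.eval_single, g.eval_deriv (hs p), dilateInvDeriv_single,
    g.eval_add (Submodule.smul_mem _ _ (hs _)) (Submodule.smul_mem _ _ (hs _)),
    g.eval_smul _ (hs _), g.eval_smul _ (hs _), g.eval_single, g.eval_single]
  ring

/-- `Λ⁻¹ ∂` looks outward, so it fails to commute with the cutoff only at `x = ±1`, where the cutoff
discards the values of `F` at `±q⁻²`. -/
theorem inner_dilateInvDeriv (F : Lattice → ℂ) :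
    inner (dilateInvDeriv q F) = dilateInvDeriv q (inner F)
      + ((F (1, -1) / ((1 - (q : ℂ) ^ 2) * (pt q (1, -1) : ℂ))) • Pi.single (1, 0) 1
        + (F (-1, -1) / ((1 - (q : ℂ) ^ 2) * (pt q (-1, -1) : ℂ))) • Pi.single (-1, 0) 1) := by
  have hne : (1 : ℤˣ) ≠ -1 := by decide
  have hne' : (-1 : ℤˣ) ≠ 1 := by decide
  funext x
  obtain ⟨ε, n⟩ := x
  simp only [Pi.add_apply, Pi.smul_apply, Pi.single_apply, smul_eq_mul, inner,
    dilateInvDeriv_apply, Prod.mk.injEq]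
  rcases lt_trichotomy n 0 with hn | hn | hn
  · have h1 : ¬ (0 ≤ n) := by omega
    have h2 : ¬ (0 ≤ n + -1) := by omega
    simp [h1, h2, hn.ne]
  · subst hn
    rcases Int.units_eq_one_or ε with rfl | rfl
    · simp [hne]
      ring
    · simp [hne']
      ring
  · have h1 : 0 ≤ n := by omega
    have h2 : 0 ≤ n + -1 := by omega
    simp [h1, h2, hn.ne']

theorem norm_inv_pt_le {p : Lattice} (hp : p.2 < 0) :
    ‖((1 - (q : ℂ) ^ 2) * (pt q p : ℂ))⁻¹‖ ≤ (1 - (q : ℝ) ^ 2)⁻¹ := by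
  have hq := base_sq_lt_one q
  have h1 : ‖(1 - (q : ℂ) ^ 2)‖ = 1 - (q : ℝ) ^ 2 := by
    have : (1 - (q : ℂ) ^ 2) = ((1 - (q : ℝ) ^ 2 : ℝ) : ℂ) := by push_cast; rfl
    rw [this, Complex.norm_real, Real.norm_of_nonneg (by linarith)]
  have h2 : 1 ≤ ‖(pt q p : ℂ)‖ := by
    have hs : |((p.1 : ℤ) : ℝ)| = 1 := by
      rcases Int.units_eq_one_or p.1 with h | h <;> simp [h]
    rw [Complex.norm_real, pt, norm_mul, Real.norm_eq_abs, hs, one_mul,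
      Real.norm_of_nonneg (zpow_nonneg q.2.1.le _)]
    exact one_le_zpow_of_nonpos₀ q.2.1 q.2.2.le (by omega)
  rw [norm_inv, norm_mul, h1]
  exact inv_anti₀ (by linarith) (le_mul_of_one_le_right (by linarith) h2)

/-- The shift by one step of the lattice, as a permutation. -/
def latticeSucc : Lattice ≃ Lattice := (Equiv.refl ℤˣ).prodCongr (Equiv.addRight 1)

/-- Summation over `|x| ≥ 1` splits off the two points `±1`. -/
theorem hasSum_shift_boundary {U : Lattice → ℂ} {a : ℂ}
    (h : HasSum (fun p : {p : Lattice // p.2 < 0} => U p) a) :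
    HasSum (fun p : {p : Lattice // p.2 < 0} => U ((p : Lattice).1, (p : Lattice).2 + 1))
      (a + (U (1, 0) + U (-1, 0))) := by
  have hne : ((1, 0) : Lattice) ≠ (-1, 0) := by decide
  have h1 : HasSum ({p : Lattice | p.2 < 0}.indicator U) a :=
    (hasSum_subtype_iff_indicator (f := U) (s := {p : Lattice | p.2 < 0})).1 h
  have h2 : HasSum ((({(1, 0), (-1, 0)} : Finset Lattice) : Set Lattice).indicator U)
      (U (1, 0) + U (-1, 0)) := by
    have := Finset.hasSum ({(1, 0), (-1, 0)} : Finset Lattice) U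
    rw [Finset.sum_pair hne] at this
    exact hasSum_subtype_iff_indicator.1 this
  refine (hasSum_subtype_iff_indicator (f := fun p : Lattice => U (p.1, p.2 + 1))
    (s := {p : Lattice | p.2 < 0})).2 ?_
  -- For `n < 0` the index `n + 1` runs over all `m ≤ 0`: the region `|x| > 1` together with `±1`.
  convert latticeSucc.hasSum_iff.2 (h1.add h2) using 1
  funext p
  obtain ⟨ε, n⟩ := p
  have hs : latticeSucc (ε, n) = (ε, n + 1) := rfl
  simp only [Function.comp_apply, hs, Set.indicator, Set.mem_ofPred_eq, Finset.coe_insert,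
    Finset.coe_singleton, Set.mem_insert_iff, Set.mem_singleton_iff, Prod.mk.injEq]
  rcases lt_trichotomy (n + 1) 0 with hn | hn | hn
  · have h1 : n < 0 := by omega
    simp [hn, h1, hn.ne]
  · have h1 : n < 0 := by omega
    rcases Int.units_eq_one_or ε with rfl | rfl <;> simp [hn, h1]
  · have h1 : ¬ n < 0 := by omega
    have h2 : ¬ n + 1 < 0 := by omega
    simp [h1, h2, hn.ne']

/-- `<∂g, F> = -q⁻² <g, Λ⁻¹ ∂ F>` for the extended pairing. -/
theorem Distr.pairing_deriv (g : Distr q) {F : Lattice → ℂ} (hF : g.PairingExists F)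
    (hD : g.PairingExists (dilateInvDeriv q F)) :
    g.deriv.PairingExists F ∧
      g.deriv.pairing F = -((q : ℂ) ^ 2)⁻¹ * g.pairing (dilateInvDeriv q F) := by
  set c : Lattice → ℂ := fun p => ((1 - (q : ℂ) ^ 2) * (pt q p : ℂ))⁻¹ with hc
  -- `U` and `V` carry the contributions of `F(q⁻² x)` and `F(x)` to `<g, Λ⁻¹ ∂ F>`. In the pairing
  -- with `∂g` the same `V` appears, but `U` is moved by one lattice step.
  set U : Lattice → ℂ := fun p => g.mass p * F (p.1, p.2 + -1) * c (p.1, p.2 + -1) with hU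
  set V : Lattice → ℂ := fun p => g.mass p * F p * c (p.1, p.2 + -1) with hV
  -- The factor `1 / ((1 - q²) q⁻² x)` is bounded on `|x| > 1`, so the series for `<g, F>` dominates
  -- `V`. Then `U = (U - V) + V` is summable as well.
  have hVs : Summable fun p : {p : Lattice // p.2 < 0} => V p := by
    refine Summable.of_norm_bounded (hF.2.norm.mul_right (1 - (q : ℝ) ^ 2)⁻¹) fun p => ?_
    rw [hV, norm_mul]
    refine mul_le_mul_of_nonneg_left (norm_inv_pt_le ?_) (norm_nonneg _)
    have := p.2
    simp only
    omega
  have hUV : ∀ p, g.mass p * dilateInvDeriv q F p = U p - V p := by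
    intro p
    rw [dilateInvDeriv_apply, div_eq_mul_inv]
    simp only [hU, hV, hc]
    ring
  have hUs : Summable fun p : {p : Lattice // p.2 < 0} => U p := by
    refine (hD.2.add hVs).congr fun p => ?_
    rw [hUV]
    ring
  have hm : ∀ p, g.deriv.mass p * F p
      = -((q : ℂ) ^ 2)⁻¹ * (U (p.1, p.2 + 1) - V p) := by
    intro p
    rw [g.mass_deriv]
    simp only [hU, hV, hc, add_neg_cancel_right]
    ring
  have hsum : HasSum (fun p : {p : Lattice // p.2 < 0} => g.deriv.mass p * F p)
      (-((q : ℂ) ^ 2)⁻¹ * ((∑' p : {p : Lattice // p.2 < 0}, U p) + (U (1, 0) + U (-1, 0))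
        - ∑' p : {p : Lattice // p.2 < 0}, V p)) := by
    simp only [hm]
    exact ((hasSum_shift_boundary hUs.hasSum).sub hVs.hasSum).mul_left _
  refine ⟨⟨hF.1, hsum.summable⟩, ?_⟩
  have hs := single_mem_testSubmodule q
  -- The correction from the cutoff is `U(1) + U(-1)`, exactly what reindexing adds to the outer sum
  -- in `hsum`.
  have hinner : g.eval (inner (dilateInvDeriv q F))
      = g.eval (dilateInvDeriv q (inner F)) + (U (1, 0) + U (-1, 0)) := by
    rw [inner_dilateInvDeriv, g.eval_add (dilateInvDeriv_mem hF.1) (add_mem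
        (Submodule.smul_mem _ _ (hs _)) (Submodule.smul_mem _ _ (hs _))),
      g.eval_add (Submodule.smul_mem _ _ (hs _)) (Submodule.smul_mem _ _ (hs _)),
      g.eval_smul _ (hs _), g.eval_smul _ (hs _), g.eval_single, g.eval_single]
    simp only [hU, hc, zero_add]
    ring
  rw [Distr.pairing, Distr.pairing, g.eval_deriv hF.1, hsum.tsum_eq, hinner]
  simp only [hUV]
  rw [hUs.tsum_sub hVs]
  ring

theorem inner_linear (a b : ℂ) (F G : Lattice → ℂ) :
    inner (a • F + b • G) = a • inner F + b • inner G := by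
  funext p
  by_cases h : 0 ≤ p.2 <;> simp [inner, h]

/-- The extended pairing is linear. -/
theorem Distr.pairing_linear (g : Distr q) {F G : Lattice → ℂ} (hF : g.PairingExists F)
    (hG : g.PairingExists G) (a b : ℂ) :
    g.pairing (a • F + b • G) = a * g.pairing F + b * g.pairing G := by
  have hsum : HasSum (fun p : {p : Lattice // p.2 < 0} => g.mass p * (a • F + b • G) p)
      (a * (∑' p : {p : Lattice // p.2 < 0}, g.mass p * F p)
        + b * ∑' p : {p : Lattice // p.2 < 0}, g.mass p * G p) := by
    refine ((hF.2.hasSum.mul_left a).add (hG.2.hasSum.mul_left b)).congr_fun fun p => ?_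
    simp only [Pi.add_apply, Pi.smul_apply, smul_eq_mul]
    ring
  rw [Distr.pairing, Distr.pairing, Distr.pairing, hsum.tsum_eq, inner_linear,
    g.eval_add (Submodule.smul_mem _ _ hF.1) (Submodule.smul_mem _ _ hG.1),
    g.eval_smul _ hF.1, g.eval_smul _ hG.1]
  ring

/-! ### The `q²`-shift -/

/-- The terms of the series of the `q²`-shift. -/
def shiftTerm (q : Base) (ψ : Lattice → ℂ) (ξ s : Lattice) (k : ℕ) : ℂ :=
  (1 - (q : ℂ) ^ 2) ^ k / qFactorial ((q : ℂ) ^ 2) ((q : ℂ) ^ 2) k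
    * (pt q ξ : ℂ) ^ k * dilate (-(k : ℤ)) ((qDeriv q ^ k) ψ) s

theorem qFactorial_succ (a b : ℂ) (n : ℕ) :
    qFactorial a b (n + 1) = qFactorial a b n * (1 - a * b ^ n) := Finset.prod_range_succ _ _

theorem qFactorial_sq_succ (q : Base) (n : ℕ) :
    qFactorial ((q : ℂ) ^ 2) ((q : ℂ) ^ 2) (n + 1)
      = qFactorial ((q : ℂ) ^ 2) ((q : ℂ) ^ 2) n * (1 - ((q : ℂ) ^ 2) ^ (n + 1)) := by
  rw [qFactorial_succ, pow_succ' _ n]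

theorem qFactorial_sq_ne_zero (q : Base) (n : ℕ) :
    qFactorial ((q : ℂ) ^ 2) ((q : ℂ) ^ 2) n ≠ 0 := by
  induction n with
  | zero => simp [qFactorial]
  | succ n ih =>
    rw [qFactorial_sq_succ]
    exact mul_ne_zero ih (one_sub_base_sq_pow_ne_zero q n)

theorem dilate_dilate (i j : ℤ) (f : Lattice → ℂ) :
    dilate i (dilate j f) = dilate (i + j) f := by
  funext p
  simp [dilate, add_assoc]

theorem sq_zpow_neg_one (q : Base) : (q : ℂ) ^ (2 * (-1 : ℤ)) = ((q : ℂ) ^ 2)⁻¹ := by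
  rw [mul_neg, mul_one, zpow_neg]
  rfl

/-- `Λ⁻ᵏ ∂ᵏ (Λ⁻¹ ∂ f) = q⁻²ᵏ Λ⁻ᵏ⁻¹ ∂ᵏ⁺¹ f`. -/
theorem dilate_qDeriv_pow_dilateInvDeriv (k : ℕ) (f : Lattice → ℂ) :
    dilate (-(k : ℤ)) ((qDeriv q ^ k) (dilateInvDeriv q f))
      = (((q : ℂ) ^ 2)⁻¹) ^ k • dilate (-((k + 1 : ℕ) : ℤ)) ((qDeriv q ^ (k + 1)) f) := by
  rw [dilateInvDeriv, LinearMap.comp_apply, qDeriv_pow_dilate, map_smul, dilate_dilate,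
    sq_zpow_neg_one, pow_succ (qDeriv q), Module.End.mul_apply]
  congr 3
  push_cast
  ring

/-- `Λ⁻¹ ∂` commutes with `Λ⁻ᵏ ∂ᵏ`. -/
theorem dilateInvDeriv_dilate_qDeriv_pow (k : ℕ) (f : Lattice → ℂ) :
    dilateInvDeriv q (dilate (-(k : ℤ)) ((qDeriv q ^ k) f))
      = dilate (-(k : ℤ)) ((qDeriv q ^ k) (dilateInvDeriv q f)) := by
  rw [dilate_qDeriv_pow_dilateInvDeriv, dilateInvDeriv, LinearMap.comp_apply, qDeriv_dilate,
    map_smul, dilate_dilate, pow_succ' (qDeriv q), Module.End.mul_apply]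
  congr 1
  · rw [inv_pow, mul_neg, zpow_neg, zpow_mul]
    norm_cast
  · congr 2
    push_cast
    ring

/-! ### Growth of `q²`-derivatives and convergence of the shift series. -/

theorem norm_one_sub_base_sq_pow (q : Base) (k : ℕ) :
    ‖1 - ((q : ℂ) ^ 2) ^ (k + 1)‖ = 1 - ((q : ℝ) ^ 2) ^ (k + 1) := by
  have h : (1 - ((q : ℂ) ^ 2) ^ (k + 1)) = ((1 - ((q : ℝ) ^ 2) ^ (k + 1) : ℝ) : ℂ) := by
    push_cast; rfl
  rw [h, Complex.norm_real, Real.norm_of_nonneg]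
  exact sub_nonneg.2 (pow_le_one₀ (base_sq_pos q).le (base_sq_lt_one q).le)

/-- Bounded functions have `q²`-derivatives of order `|x|⁻ᵏ`. -/
theorem norm_qDeriv_pow_le {f : Lattice → ℂ} {C : ℝ} (hf : ∀ p, ‖f p‖ ≤ C) (k : ℕ) (p : Lattice) :
    ‖(qDeriv q ^ k) f p‖
      ≤ C * (∏ i ∈ Finset.range k, (1 + (((q : ℝ) ^ 2) ^ i)⁻¹))
        / ((1 - (q : ℝ) ^ 2) * |pt q p|) ^ k := by
  induction k generalizing p with
  | zero => simpa using hf p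
  | succ k ih =>
    set P := ∏ i ∈ Finset.range k, (1 + (((q : ℝ) ^ 2) ^ i)⁻¹) with hP
    have h1 : ‖(1 - (q : ℂ) ^ 2)‖ = 1 - (q : ℝ) ^ 2 := by
      simpa using norm_one_sub_base_sq_pow q 0
    have hq0 := base_sq_pos q
    have hq1 : 0 < 1 - (q : ℝ) ^ 2 := sub_pos.2 (base_sq_lt_one q)
    have hx : 0 < |pt q p| := abs_pos.2 (pt_ne_zero q p)
    have hs : |pt q (p.1, p.2 + 1)| = (q : ℝ) ^ 2 * |pt q p| := by
      rw [pt_shift, abs_mul, mul_one, show (q : ℝ) ^ (2 : ℤ) = (q : ℝ) ^ 2 from rfl,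
        abs_of_pos hq0]
    have ih1 := ih p
    -- At `q² x` the bound of order `k` grows by `q⁻²ᵏ`, which produces the new factor `1 + q⁻²ᵏ`.
    have ih2 := ih (p.1, p.2 + 1)
    rw [hs] at ih2
    rw [pow_succ', Module.End.mul_apply, Finset.prod_range_succ, ← hP]
    set h := (qDeriv q ^ k) f
    change ‖(h p - h (p.1, p.2 + 1)) / ((1 - (q : ℂ) ^ 2) * (pt q p : ℂ))‖ ≤ _
    rw [norm_div, norm_mul, h1, Complex.norm_real, Real.norm_eq_abs]
    rw [div_le_iff₀ (mul_pos hq1 hx)]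
    refine ((norm_sub_le _ _).trans (add_le_add ih1 ih2)).trans (le_of_eq ?_)
    generalize (q : ℝ) ^ 2 = a at *
    have ha : a ^ k ≠ 0 := by positivity
    simp only [mul_pow, pow_succ]
    field_simp

/-- Evaluating the `k`-th derivative at `q⁻²ᵏ s` gains `|q⁻²ᵏ s|⁻ᵏ`, that is, `a^(k²)` with `a =
q²`. The product of the `1 + a⁻ⁱ` loses only about `a^(-k²/2)`, so the terms decay faster than any
geometric series. -/
theorem shiftTerm_summable {ψ : Lattice → ℂ} {C : ℝ} (hψ : ∀ p, ‖ψ p‖ ≤ C) (ξ s : Lattice) :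
    Summable (shiftTerm q ψ ξ s) := by
  have hq0 := base_sq_pos q
  have hq1 : 0 < 1 - (q : ℝ) ^ 2 := sub_pos.2 (base_sq_lt_one q)
  have hx : 0 < |pt q ξ| := abs_pos.2 (pt_ne_zero q ξ)
  have hs : 0 < |pt q s| := abs_pos.2 (pt_ne_zero q s)
  set a : ℝ := (q : ℝ) ^ 2 with ha
  set M : ℝ := |pt q ξ| / |pt q s| with hM
  have hM0 : 0 < M := div_pos hx hs
  have hden : ∀ k : ℕ, 0 < 1 - a ^ (k + 1) := fun k =>
    sub_pos.2 (pow_lt_one₀ hq0.le (base_sq_lt_one q) k.succ_ne_zero)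
  -- The majorant is a product so that the ratio test can be read off, its ratios tending to `0`.
  -- The exponents `2i + 1` come from `k² = ∑ (2i + 1)`; the powers of `1 - q²` cancel against those
  -- in the derivative bound.
  let B : ℕ → ℝ := fun k => ∏ i ∈ Finset.range k,
    (M * a ^ (2 * i + 1) * (1 + (a ^ i)⁻¹) / (1 - a ^ (i + 1)))
  have hBsucc : ∀ k, B (k + 1)
      = B k * (M * a ^ (2 * k + 1) * (1 + (a ^ k)⁻¹) / (1 - a ^ (k + 1))) := fun k =>
    Finset.prod_range_succ _ _
  have hBpos : ∀ k, 0 < B k := fun k => Finset.prod_pos fun i _ => by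
    have := hden i
    positivity
  have hBsum : Summable B := by
    refine summable_of_ratio_test_tendsto_lt_one (l := 0) zero_lt_one
      (Filter.Eventually.of_forall fun k => (hBpos k).ne') ?_
    have hlim : Filter.Tendsto (fun k : ℕ => M * (a * (a ^ k * a ^ k) + a * a ^ k)
        / (1 - a * a ^ k)) Filter.atTop (nhds (M * (a * (0 * 0) + a * 0) / (1 - a * 0))) := by
      have h0 := tendsto_pow_atTop_nhds_zero_of_lt_one hq0.le (base_sq_lt_one q)
      exact (((((h0.mul h0).const_mul a).add (h0.const_mul a)).const_mul M)).div
        ((h0.const_mul a).const_sub 1) (by simp)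
    simp only [mul_zero, add_zero, zero_div] at hlim
    refine hlim.congr fun k => ?_
    rw [hBsucc, Real.norm_of_nonneg (mul_nonneg (hBpos k).le ?_), Real.norm_of_nonneg (hBpos k).le,
      mul_div_cancel_left₀ _ (hBpos k).ne']
    · rw [pow_succ a k, mul_comm (a ^ k) a]
      congr 1
      have : a ^ k ≠ 0 := by positivity
      field_simp
      ring
    · have := hden k
      positivity
  refine Summable.of_norm_bounded (hBsum.mul_left C) fun k => ?_
  have hfac : ∀ k, ‖qFactorial ((q : ℂ) ^ 2) ((q : ℂ) ^ 2) k‖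
      = ∏ i ∈ Finset.range k, (1 - a ^ (i + 1)) := by
    intro k
    rw [qFactorial, norm_prod]
    refine Finset.prod_congr rfl fun i _ => ?_
    rw [← pow_succ', norm_one_sub_base_sq_pow]
  have h1 : ‖(1 - (q : ℂ) ^ 2)‖ = 1 - a := by
    simpa using norm_one_sub_base_sq_pow q 0
  have hsk : |pt q (s.1, s.2 + -(k : ℤ))| = (a ^ k)⁻¹ * |pt q s| := by
    rw [pt_shift, abs_mul]
    congr 1
    rw [mul_neg, zpow_neg, zpow_mul, abs_inv, zpow_natCast,
      show (q : ℝ) ^ (2 : ℤ) = a from rfl, abs_of_pos (pow_pos hq0 k)]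
  have hb := norm_qDeriv_pow_le (q := q) hψ k (s.1, s.2 + -(k : ℤ))
  rw [hsk, ← ha] at hb
  have hprod : B k = M ^ k * (∏ i ∈ Finset.range k, a ^ (2 * i + 1))
      * (∏ i ∈ Finset.range k, (1 + (a ^ i)⁻¹)) / ∏ i ∈ Finset.range k, (1 - a ^ (i + 1)) := by
    simp only [B, Finset.prod_div_distrib, Finset.prod_mul_distrib, Finset.prod_const,
      Finset.card_range]
  have hsq : (∏ i ∈ Finset.range k, a ^ (2 * i + 1)) = (a ^ k) ^ k := by
    rw [Finset.prod_pow_eq_pow_sum, ← pow_mul a k k]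
    refine congrArg (a ^ ·) ?_
    clear hb hsk hprod
    induction k with
    | zero => simp
    | succ k ih => rw [Finset.sum_range_succ, ih]; ring
  rw [shiftTerm, norm_mul, norm_mul, norm_div, norm_pow, norm_pow, h1, hfac, Complex.norm_real,
    Real.norm_eq_abs]
  change _ * ‖(qDeriv q ^ k) ψ (s.1, s.2 + -(k : ℤ))‖ ≤ _
  have hQ : 0 < ∏ i ∈ Finset.range k, (1 - a ^ (i + 1)) := Finset.prod_pos fun i _ => hden i
  refine (mul_le_mul_of_nonneg_left hb (by positivity)).trans (le_of_eq ?_)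
  rw [hprod, hsq, hM]
  have ha' : a ^ k ≠ 0 := by positivity
  have h1a : (1 - a) ≠ 0 := hq1.ne'
  generalize (∏ i ∈ Finset.range k, (1 - a ^ (i + 1))) = Q at *
  generalize (∏ i ∈ Finset.range k, (1 + (a ^ i)⁻¹)) = R at *
  have hQ' := hQ.ne'
  simp only [mul_pow, div_pow, inv_pow]
  field_simp

theorem TestFun.norm_le (ψ : TestFun q) : ∃ C : ℝ, ∀ p, ‖ψ p‖ ≤ C := by
  simpa [weighted] using ψ.2 0 0

theorem TestFun.shift_summable (ψ : TestFun q) (ξ s : Lattice) :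
    Summable (shiftTerm q ψ ξ s) := by
  obtain ⟨C, hC⟩ := ψ.norm_le
  exact shiftTerm_summable hC ξ s

/-! ### Derivatives of the shift in each variable. -/

/-- `Λ⁻¹ ∂` in the variable `s` commutes with the `q²`-shift. -/
theorem dilateInvDeriv_shift_right (ψ : TestFun q) (ξ : Lattice) :
    dilateInvDeriv q (fun s => shift q ψ ξ s) = fun s => shift q (testDilateInvDeriv q ψ) ξ s := by
  funext s
  rw [dilateInvDeriv_apply]
  change (tsum (shiftTerm q ψ ξ (s.1, s.2 + -1)) - tsum (shiftTerm q ψ ξ s)) / _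
    = tsum (shiftTerm q (testDilateInvDeriv q ψ) ξ s)
  rw [← (ψ.shift_summable _ _).tsum_sub (ψ.shift_summable _ _), ← tsum_div_const]
  refine tsum_congr fun k => ?_
  rw [coe_testDilateInvDeriv]
  simp only [shiftTerm]
  rw [← dilateInvDeriv_dilate_qDeriv_pow, dilateInvDeriv_apply]
  ring

/-- `Λ⁻¹ ∂` in the variable `ξ` acts on the `q²`-shift as on the function. -/
theorem dilateInvDeriv_shift_left (ψ : TestFun q) (s : Lattice) :
    dilateInvDeriv q (fun ξ => shift q ψ ξ s) = fun ξ => shift q (testDilateInvDeriv q ψ) ξ s := by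
  funext ξ
  rw [dilateInvDeriv_apply]
  change (tsum (shiftTerm q ψ (ξ.1, ξ.2 + -1) s) - tsum (shiftTerm q ψ ξ s)) / _
    = tsum (shiftTerm q (testDilateInvDeriv q ψ) ξ s)
  have hsub := (ψ.shift_summable (ξ.1, ξ.2 + -1) s).sub (ψ.shift_summable ξ s)
  -- The term `k = 0` does not depend on `ξ`; once it drops out, term `k + 1` of the difference
  -- matches term `k` on the right.
  rw [← (ψ.shift_summable _ _).tsum_sub (ψ.shift_summable _ _), hsub.tsum_eq_zero_add,
    show shiftTerm q ψ (ξ.1, ξ.2 + -1) s 0 - shiftTerm q ψ ξ s 0 = 0 by simp [shiftTerm],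
    zero_add, ← tsum_div_const]
  refine tsum_congr fun k => ?_
  rw [coe_testDilateInvDeriv]
  simp only [shiftTerm]
  -- With `y = q⁻² ξ`, `y^(k+1) - (q² y)^(k+1) = (1 - q^(2(k+1))) y^(k+1)`: the bracket cancels the
  -- last factor of the `q`-factorial, and `y^k = q⁻²ᵏ ξ^k` supplies the power from the commutation
  -- rule.
  rw [dilate_qDeriv_pow_dilateInvDeriv, Pi.smul_apply, smul_eq_mul, qFactorial_sq_succ,
    ← sq_mul_pt_sub_one q ξ]
  have h1 := base_sq_ne_zero q
  have h2 := ofReal_pt_ne_zero q (ξ.1, ξ.2 + -1)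
  have h3 := one_sub_base_sq_ne_zero q
  have h4 := one_sub_base_sq_pow_ne_zero q k
  have h5 := qFactorial_sq_ne_zero q k
  generalize dilate (-((k + 1 : ℕ) : ℤ)) ((qDeriv q ^ (k + 1)) ψ) s = v
  generalize (q : ℂ) ^ 2 = a at *
  generalize (pt q (ξ.1, ξ.2 + -1) : ℂ) = x at *
  generalize qFactorial a a k = Q at *
  rw [mul_pow, mul_pow, inv_pow]
  field_simp
  ring

/-! ### Convolution -/

/-- Existence of `g * r`, used for both `ψ` and `Λ⁻¹ ∂ ψ`, supplies the two pairings that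
`Distr.pairing_deriv` requires. -/
theorem ConvExists.convFun_deriv_left {g r : Distr q} (h : ConvExists g r) (ψ : TestFun q) :
    (∀ s : Lattice, s.1 ∈ r.signSupport → g.deriv.PairingExists fun ξ => shift q ψ ξ s) ∧
      convFun g.deriv r ψ = (-((q : ℂ) ^ 2)⁻¹) • convFun g r (testDilateInvDeriv q ψ) := by
  have key : ∀ s : Lattice, s.1 ∈ r.signSupport →
      g.deriv.PairingExists (fun ξ => shift q ψ ξ s) ∧
        g.deriv.pairing (fun ξ => shift q ψ ξ s) = -((q : ℂ) ^ 2)⁻¹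
          * g.pairing (fun ξ => shift q (testDilateInvDeriv q ψ) ξ s) := by
    intro s hs
    rw [← dilateInvDeriv_shift_left]
    refine g.pairing_deriv ((h ψ).1 s hs) ?_
    rw [dilateInvDeriv_shift_left]
    exact (h (testDilateInvDeriv q ψ)).1 s hs
  refine ⟨fun s hs => (key s hs).1, ?_⟩
  funext s
  by_cases hs : s.1 ∈ r.signSupport
  · simp [convFun, hs, (key s hs).2]
  · simp [convFun, hs]

/-- `Λ⁻¹ ∂ (g * ψ) = g * (Λ⁻¹ ∂ ψ)`. -/
theorem ConvExists.dilateInvDeriv_convFun {g r : Distr q} (h : ConvExists g r) (ψ : TestFun q) :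
    dilateInvDeriv q (convFun g r ψ) = convFun g r (testDilateInvDeriv q ψ) := by
  funext s
  rw [dilateInvDeriv_apply]
  by_cases hs : s.1 ∈ r.signSupport
  · have hs' : ((s.1, s.2 + -1) : Lattice).1 ∈ r.signSupport := hs
    set d := (1 - (q : ℂ) ^ 2) * (pt q (s.1, s.2 + -1) : ℂ) with hd
    -- In `s`, `Λ⁻¹ ∂` is a difference quotient of two values, so it passes through the pairing by
    -- linearity alone; no continuity in `s` is involved.
    have hlin : (fun ξ => shift q (testDilateInvDeriv q ψ) ξ s)
        = d⁻¹ • (fun ξ => shift q ψ ξ (s.1, s.2 + -1)) + (-d⁻¹) • fun ξ => shift q ψ ξ s := by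
      funext ξ
      have := congrFun (dilateInvDeriv_shift_right ψ ξ) s
      rw [dilateInvDeriv_apply] at this
      rw [← this]
      simp only [Pi.add_apply, Pi.smul_apply, smul_eq_mul]
      ring
    simp only [convFun, if_pos hs]
    rw [hlin, g.pairing_linear ((h ψ).1 _ hs') ((h ψ).1 _ hs)]
    ring
  · simp [convFun, hs]

/-- The second distribution enters `convFun` only through its set of signs. -/
theorem convFun_deriv_right {g r : Distr q} (ψ : TestFun q) :
    convFun g r.deriv ψ = signRestrict r.deriv.signSupport (convFun g r ψ) := by
  funext s
  by_cases hs : s.1 ∈ r.deriv.signSupport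
  · rw [signRestrict_apply_of_mem _ hs]
    simp only [convFun, if_pos hs, if_pos (r.signSupport_deriv_subset hs)]
  · rw [signRestrict_apply_of_notMem _ hs]
    simp only [convFun, if_neg hs]

theorem ConvExists.deriv_left {g r : Distr q} (h : ConvExists g r) : ConvExists g.deriv r := by
  intro ψ
  refine ⟨(h.convFun_deriv_left ψ).1, ?_⟩
  rw [(h.convFun_deriv_left ψ).2]
  exact Submodule.smul_mem _ _ (h _).2

theorem ConvExists.deriv_right {g r : Distr q} (h : ConvExists g r) : ConvExists g r.deriv := by
  intro ψ
  refine ⟨fun s hs => (h ψ).1 s (r.signSupport_deriv_subset hs), ?_⟩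
  rw [convFun_deriv_right]
  exact signRestrict_mem _ (h ψ).2

theorem ConvExists.conv_deriv_left {g r : Distr q} (h : ConvExists g r) (ψ : TestFun q) :
    conv g.deriv r ψ = conv g r.deriv ψ := by
  -- The two functions agree on the half-lattices of `∂r`, and `∂r` does not see the others.
  have hrestr : r.deriv.eval (convFun g r.deriv ψ) = r.deriv.eval (convFun g r ψ) := by
    refine r.deriv.eval_congr_signSupport (h.deriv_right ψ).2 (h ψ).2 fun p hp => ?_
    rw [convFun_deriv_right, signRestrict_apply_of_mem _ hp]
  rw [conv, conv, hrestr, r.eval_deriv (h ψ).2, h.dilateInvDeriv_convFun,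
    (h.convFun_deriv_left ψ).2, r.eval_smul _ (h _).2]

end

end QConvolution

theorem proposition5p4 (q : QConvolution.Base) (g r : QConvolution.Distr q)
    (h : QConvolution.ConvExists g r) :
    QConvolution.ConvExists (QConvolution.Distr.deriv g) r ∧ QConvolution.ConvExists g (QConvolution.Distr.deriv r) ∧
      ∀ ψ : QConvolution.TestFun q,
        QConvolution.conv (QConvolution.Distr.deriv g) r ψ = QConvolution.conv g (QConvolution.Distr.deriv r) ψ :=
  ⟨h.deriv_left, h.deriv_right, h.conv_deriv_left⟩
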